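/- Let $\theta>0$ and let $\mathcal X$ be a Poisson point process on $(0,\infty)$ with intensity measure $\frac{\theta}{x}\,dx$. Almost surely its points can be labelled as \[0<\dots<X_3<X_2<X_1<1\le X_0<X_{-1}<X_{-2}<\dots<\infty .\] Put $Y_k:=X_{k-1}-X_k$ for $k\in\mathbb Z$, and let \[\mathcal V:=\{1-X_1,\ X_1-X_2,\ X_2-X_3,\dots\},\qquad \mathcal W:=\{Y_k:\ k\in\mathbb Z,\ Y_k<1\}.\] There is a constant $C(\theta)<\infty$, depending only on $\theta$, such that \[\mathbb E\big[(\#\,\mathcal V\Delta\mathcal W)^2\big]\le C(\theta),\] and, with the same constant, for every measurable function $f:\mathbb R\to\mathbb R$, \[\mathbb E\Big[\Big(\sum_{x\in\mathcal V\setminus\mathcal W}f(x)-\sum_{x\in\mathcal W\setminus\mathcal V}f(x)\Big)^2\Big]\le C(\theta)\,\|f\|_\infty^2,\qquad \|f\|_\infty:=\sup_{x\in\mathbb R}|f(x)|\in[0,\infty].\] Moreover, almost surely, $\sum_{x\in\mathcal V}f(x)$ converges absolutely if and only if $\sum_{x\in\mathcal W}f(x)$ does, and if this is almost surely the case, then \[\mathbb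 E\Big[\Big(\sum_{x\in\mathcal V}f(x)-\sum_{x\in\mathcal W}f(x)\Big)^2\Big]\le C(\theta)\,\|f\|_\infty^2 .\] The random quantities in these expectations are measurable up to null sets. -/

import Mathlib

open Set MeasureTheory ProbabilityTheory
open scoped NNReal ENNReal

noncomputable section

/-- The (random) set of points `N` is a Poisson process with intensity measure `Λ` on the
probability space `(Ω, P)`: the number of points in a measurable set `B` is a Poisson variable of
parameter `Λ B` (almost surely infinite if `Λ B = ∞`), and the numbers of points in finitely many
pairwise disjoint measurable sets are independent. -/
structure IsPoissonProcess {Ω : Type*} [MeasurableSpace Ω] {E : Type*} [MeasurableSpace E]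
    (N : Ω → Set E) (Λ : Measure E) (P : Measure Ω) : Prop where
  measurable_count : ∀ B : Set E, MeasurableSet B → Measurable fun ω => (N ω ∩ B).encard
  count_law : ∀ B : Set E, MeasurableSet B → Λ B ≠ ∞ →
    P.map (fun ω => (N ω ∩ B).encard) =
      (poissonMeasure (Λ B).toNNReal).map (fun n : ℕ => (n : ℕ∞))
  count_eq_top : ∀ B : Set E, MeasurableSet B → Λ B = ∞ → ∀ᵐ ω ∂P, (N ω ∩ B).encard = ⊤
  indep_count : ∀ (n : ℕ) (B : Fin n → Set E), (∀ i, MeasurableSet (B i)) →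
    Pairwise (fun i j => Disjoint (B i) (B j)) →
    iIndepFun (fun i ω => (N ω ∩ B i).encard) P

/-- The measure `(θ / x) dx` on `(0, ∞)`, seen as a measure on the real line. -/
def scaleInvariantIntensity (θ : ℝ) : Measure ℝ :=
  (volume.restrict (Ioi 0)).withDensity fun x => ENNReal.ofReal (θ / x)

/-- The points of `S` below `1`, in decreasing order: the largest one, the second largest one,
and so on (for a set `S` that has infinitely many points in `(0, 1)`, finitely many of them in
`[ε, 1)` for every `ε > 0`). -/
def pointBelowOne (S : Set ℝ) : ℕ → ℝ
  | 0 => sSup (S ∩ Iio 1)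
  | n + 1 => sSup (S ∩ Iio (pointBelowOne S n))

/-- The points of `S` in `[1, ∞)`, in increasing order (for a set `S` that has infinitely many
points in `[1, ∞)`, finitely many of them in every bounded set). -/
def pointAboveOne (S : Set ℝ) : ℕ → ℝ
  | 0 => sInf (S ∩ Ici 1)
  | n + 1 => sInf (S ∩ Ioi (pointAboveOne S n))

/-- The labelling `⋯ < X₃ < X₂ < X₁ < 1 ≤ X₀ < X₋₁ < X₋₂ < ⋯` of the points of `S`. -/
def labelledPoint (S : Set ℝ) (k : ℤ) : ℝ :=
  if 1 ≤ k then pointBelowOne S (k - 1).toNat else pointAboveOne S (-k).toNat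

/-- The spacing `Yₖ = Xₖ₋₁ - Xₖ`. -/
def spacing (S : Set ℝ) (k : ℤ) : ℝ := labelledPoint S (k - 1) - labelledPoint S k

/-- `𝒱 = {1 - X₁, X₁ - X₂, X₂ - X₃, …}`. -/
def spacingsBelowOne (S : Set ℝ) : Set ℝ :=
  {y | y = 1 - labelledPoint S 1 ∨
    ∃ k : ℤ, 1 ≤ k ∧ y = labelledPoint S k - labelledPoint S (k + 1)}

/-- `𝒲 = {Yₖ : k ∈ ℤ, Yₖ < 1}`. -/
def smallSpacings (S : Set ℝ) : Set ℝ :=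
  {y | ∃ k : ℤ, y = spacing S k ∧ spacing S k < 1}

/-- The difference `∑_{x ∈ V} f x - ∑_{x ∈ W} f x` after cancellation of the terms with
`x ∈ V ∩ W`. It involves finite sums only as soon as the symmetric difference of `V` and `W` is
finite, even if the two sums themselves diverge. -/
def sumDifference (V W : Set ℝ) (f : ℝ → ℝ) : ℝ :=
  (∑' x : ↥(V \ W), f x) - ∑' x : ↥(W \ V), f x

end

/-! For `k ≥ 2` the spacing `Yₖ` lies between two points below `1`, so it is automatically less than
`1` and belongs to both sets. The symmetric difference therefore consists at most of `1 - X₁`, `Y₁`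
and the small spacings above `1` (`encard_symmDiff_spacings_le`).

To count the latter, cut `[1, ∞)` into unit blocks. A block contributes at most its number of
points, and nothing if it has one point and the next block is empty (`encard_closePairs_block_le`).
Block `j` has Poisson mean at most `θ / (j + 1)`, so two points in it, or a point in both it and its
successor, cost order `j⁻²`. This is summable, also for second moments
(`lintegral_blockBound_sq_le`). Blocks at distance at least two contribute independently, which
bounds the second moment of the total (`lintegral_tsum_sq_le`).

The claims on `f` follow: the cancelled difference is at most the cardinality times the supremum of
`|f|`, and finitely many terms affect neither summability nor the cancellation. Measurability comes
from enumerating both sets by countably many random variables. -/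

/-! ### Measurability of the labelled points -/

theorem measurable_sSup_of_measurableSet_nonempty {Ω : Type*} [MeasurableSpace Ω] {T : Ω → Set ℝ}
    (hb : ∀ ω, BddAbove (T ω)) (hT : ∀ a : ℝ, MeasurableSet {ω | (T ω ∩ Ioi a).Nonempty}) :
    Measurable fun ω => sSup (T ω) := by
  refine measurable_of_Ioi fun a => ?_
  have hne : MeasurableSet {ω | (T ω).Nonempty} := by
    have : {ω | (T ω).Nonempty} = ⋃ n : ℕ, {ω | (T ω ∩ Ioi (-(n : ℝ))).Nonempty} := by
      ext ω
      simp only [mem_ofPred_eq, mem_iUnion]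
      constructor
      · rintro ⟨x, hx⟩
        obtain ⟨n, hn⟩ := exists_nat_gt (-x)
        exact ⟨n, x, hx, by simp only [mem_Ioi]; linarith⟩
      · rintro ⟨n, x, hx, -⟩
        exact ⟨x, hx⟩
    rw [this]
    exact MeasurableSet.iUnion fun n => hT _
  -- Since `sSup ∅ = 0`, the empty set counts exactly when `a < 0`.
  have : (fun ω => sSup (T ω)) ⁻¹' Ioi a
      = {ω | (T ω ∩ Ioi a).Nonempty} ∪ ({ω | (T ω).Nonempty}ᶜ ∩ {_ω | a < 0}) := by
    ext ω
    simp only [mem_preimage, mem_Ioi, mem_union, mem_ofPred_eq, mem_inter_iff, mem_compl_iff]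
    rcases (T ω).eq_empty_or_nonempty with h | h
    · simp [h]
    · rw [lt_csSup_iff (hb ω) h]
      simp only [h, not_true_eq_false, false_and, or_false]
      rfl
  rw [this]
  exact (hT a).union (hne.compl.inter (MeasurableSet.const _))

theorem measurable_sInf_of_measurableSet_nonempty {Ω : Type*} [MeasurableSpace Ω] {T : Ω → Set ℝ}
    (hb : ∀ ω, BddBelow (T ω)) (hT : ∀ a : ℝ, MeasurableSet {ω | (T ω ∩ Iio a).Nonempty}) :
    Measurable fun ω => sInf (T ω) := by
  simp_rw [Real.sInf_def]
  refine (measurable_sSup_of_measurableSet_nonempty (fun ω => (hb ω).neg) fun a => ?_).neg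
  convert hT (-a) using 3 with ω
  rw [← Set.nonempty_neg]
  simp [Set.inter_neg]

/-- A rational between the point and the random level `Z ω` reduces the event to hitting
deterministic intervals. -/
theorem measurable_sSup_inter_Iio {Ω : Type*} [MeasurableSpace Ω] {S : Ω → Set ℝ}
    (hS : ∀ B : Set ℝ, MeasurableSet B → MeasurableSet {ω | (S ω ∩ B).Nonempty})
    {Z : Ω → ℝ} (hZ : Measurable Z) : Measurable fun ω => sSup (S ω ∩ Iio (Z ω)) := by
  refine measurable_sSup_of_measurableSet_nonempty
    (fun ω => bddAbove_Iio.mono inter_subset_right) fun a => ?_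
  have : {ω | (S ω ∩ Iio (Z ω) ∩ Ioi a).Nonempty}
      = ⋃ q : ℚ, {ω | (q : ℝ) < Z ω} ∩ {ω | (S ω ∩ Ioo a q).Nonempty} := by
    ext ω
    simp only [mem_ofPred_eq, mem_iUnion, mem_inter_iff]
    constructor
    · rintro ⟨x, ⟨hx, hxZ⟩, hxa⟩
      obtain ⟨q, h1, h2⟩ := exists_rat_btwn (mem_Iio.1 hxZ)
      exact ⟨q, h2, x, hx, hxa, h1⟩
    · rintro ⟨q, hq, x, hx, hxa, hxq⟩
      exact ⟨x, ⟨hx, hxq.trans hq⟩, hxa⟩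
  rw [this]
  exact MeasurableSet.iUnion fun q =>
    (measurableSet_lt measurable_const hZ).inter (hS _ measurableSet_Ioo)

theorem measurable_sInf_inter_Ioi {Ω : Type*} [MeasurableSpace Ω] {S : Ω → Set ℝ}
    (hS : ∀ B : Set ℝ, MeasurableSet B → MeasurableSet {ω | (S ω ∩ B).Nonempty})
    {Z : Ω → ℝ} (hZ : Measurable Z) : Measurable fun ω => sInf (S ω ∩ Ioi (Z ω)) := by
  refine measurable_sInf_of_measurableSet_nonempty
    (fun ω => bddBelow_Ioi.mono inter_subset_right) fun a => ?_
  have : {ω | (S ω ∩ Ioi (Z ω) ∩ Iio a).Nonempty}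
      = ⋃ q : ℚ, {ω | Z ω < (q : ℝ)} ∩ {ω | (S ω ∩ Ioo q a).Nonempty} := by
    ext ω
    simp only [mem_ofPred_eq, mem_iUnion, mem_inter_iff]
    constructor
    · rintro ⟨x, ⟨hx, hxZ⟩, hxa⟩
      obtain ⟨q, h1, h2⟩ := exists_rat_btwn (mem_Ioi.1 hxZ)
      exact ⟨q, h1, x, hx, h2, hxa⟩
    · rintro ⟨q, hq, x, hx, hxa, hxq⟩
      exact ⟨x, ⟨hx, hq.trans hxa⟩, hxq⟩
  rw [this]
  exact MeasurableSet.iUnion fun q =>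
    (measurableSet_lt hZ measurable_const).inter (hS _ measurableSet_Ioo)

theorem measurable_pointBelowOne {Ω : Type*} [MeasurableSpace Ω] {S : Ω → Set ℝ}
    (hS : ∀ B : Set ℝ, MeasurableSet B → MeasurableSet {ω | (S ω ∩ B).Nonempty}) (n : ℕ) :
    Measurable fun ω => pointBelowOne (S ω) n := by
  induction n with
  | zero => exact measurable_sSup_inter_Iio hS measurable_const
  | succ n ih => exact measurable_sSup_inter_Iio hS ih

theorem measurable_pointAboveOne {Ω : Type*} [MeasurableSpace Ω] {S : Ω → Set ℝ}
    (hS : ∀ B : Set ℝ, MeasurableSet B → MeasurableSet {ω | (S ω ∩ B).Nonempty}) (n : ℕ) :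
    Measurable fun ω => pointAboveOne (S ω) n := by
  induction n with
  | zero =>
    refine measurable_sInf_of_measurableSet_nonempty
      (fun ω => bddBelow_Ici.mono inter_subset_right) fun a => ?_
    simp_rw [inter_assoc]
    exact hS _ (measurableSet_Ici.inter measurableSet_Iio)
  | succ n ih => exact measurable_sInf_inter_Ioi hS ih

theorem measurable_labelledPoint {Ω : Type*} [MeasurableSpace Ω] {S : Ω → Set ℝ}
    (hS : ∀ B : Set ℝ, MeasurableSet B → MeasurableSet {ω | (S ω ∩ B).Nonempty}) (k : ℤ) :
    Measurable fun ω => labelledPoint (S ω) k := by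
  unfold labelledPoint
  split_ifs
  · exact measurable_pointBelowOne hS _
  · exact measurable_pointAboveOne hS _

theorem measurable_spacing {Ω : Type*} [MeasurableSpace Ω] {S : Ω → Set ℝ}
    (hS : ∀ B : Set ℝ, MeasurableSet B → MeasurableSet {ω | (S ω ∩ B).Nonempty}) (k : ℤ) :
    Measurable fun ω => spacing (S ω) k :=
  (measurable_labelledPoint hS _).sub (measurable_labelledPoint hS _)

/-! ### Measurable enumerations of random sets -/

/-- A random set of reals enumerated by a sequence of random variables, the `n`-th of which is
counted only on a measurable event. -/
def IsMeasurablyEnumerated {Ω : Type*} [MeasurableSpace Ω] (T : Ω → Set ℝ) : Prop :=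
  ∃ (v : ℕ → Ω → ℝ) (A : ℕ → Set Ω), (∀ n, Measurable (v n)) ∧ (∀ n, MeasurableSet (A n)) ∧
    ∀ ω, T ω = {y | ∃ n, ω ∈ A n ∧ y = v n ω}

namespace IsMeasurablyEnumerated

variable {Ω : Type*} [MeasurableSpace Ω] {T U : Ω → Set ℝ}

theorem of_denumerable {ι : Type*} [Denumerable ι] (v : ι → Ω → ℝ) (A : ι → Set Ω)
    (hv : ∀ i, Measurable (v i)) (hA : ∀ i, MeasurableSet (A i))
    (hT : ∀ ω, T ω = {y | ∃ i, ω ∈ A i ∧ y = v i ω}) : IsMeasurablyEnumerated T := by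
  refine ⟨fun n => v ((Denumerable.eqv ι).symm n), fun n => A ((Denumerable.eqv ι).symm n),
    fun n => hv _, fun n => hA _, fun ω => ?_⟩
  rw [hT]
  ext y
  exact ((Denumerable.eqv ι).symm.exists_congr_left
    (p := fun n => ω ∈ A ((Denumerable.eqv ι).symm n) ∧ y = v ((Denumerable.eqv ι).symm n) ω)
    |>.trans (by simp)).symm

theorem union (hT : IsMeasurablyEnumerated T) (hU : IsMeasurablyEnumerated U) :
    IsMeasurablyEnumerated fun ω => T ω ∪ U ω := by
  obtain ⟨v, A, hv, hA, hT⟩ := hT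
  obtain ⟨w, B, hw, hB, hU⟩ := hU
  refine of_denumerable (Sum.elim v w) (Sum.elim A B) ?_ ?_ fun ω => ?_
  · rintro (n | n)
    exacts [hv n, hw n]
  · rintro (n | n)
    exacts [hA n, hB n]
  · rw [hT, hU]
    ext y
    simp

theorem diff (hT : IsMeasurablyEnumerated T) (hU : IsMeasurablyEnumerated U) :
    IsMeasurablyEnumerated fun ω => T ω \ U ω := by
  obtain ⟨v, A, hv, hA, hT⟩ := hT
  obtain ⟨w, B, hw, hB, hU⟩ := hU
  refine ⟨v, fun n => A n \ ⋃ m, B m ∩ {ω | v n ω = w m ω}, hv, fun n => (hA n).diff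
    (MeasurableSet.iUnion fun m => (hB m).inter (measurableSet_eq_fun (hv n) (hw m))), fun ω => ?_⟩
  beta_reduce
  rw [hT, hU]
  ext y
  simp only [mem_sdiff, mem_ofPred_eq, mem_iUnion, mem_inter_iff]
  constructor
  · rintro ⟨⟨n, hn, rfl⟩, h⟩
    exact ⟨n, ⟨hn, h⟩, rfl⟩
  · rintro ⟨n, ⟨hn, h⟩, rfl⟩
    exact ⟨⟨n, hn, rfl⟩, h⟩

/-- An index is dropped when an earlier active index has the same value. Each element is then
counted once, so cardinalities and sums become series of indicators. -/
theorem exists_injOn (hT : IsMeasurablyEnumerated T) :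
    ∃ (v : ℕ → Ω → ℝ) (D : ℕ → Set Ω), (∀ n, Measurable (v n)) ∧ (∀ n, MeasurableSet (D n)) ∧
      ∀ ω, InjOn (fun n => v n ω) {n | ω ∈ D n} ∧ T ω = (fun n => v n ω) '' {n | ω ∈ D n} := by
  obtain ⟨v, A, hv, hA, hT⟩ := hT
  refine ⟨v, fun n => A n \ ⋃ m ∈ Iio n, A m ∩ {ω | v m ω = v n ω}, hv, fun n => (hA n).diff
    (MeasurableSet.biUnion (to_countable _) fun m _ => (hA m).inter
      (measurableSet_eq_fun (hv m) (hv n))), fun ω => ⟨?_, ?_⟩⟩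
  · intro n hn m hm hnm
    simp only [mem_ofPred_eq, mem_sdiff, mem_iUnion, mem_inter_iff, not_exists, not_and, mem_Iio]
      at hn hm
    rcases lt_trichotomy n m with h | h | h
    · exact (hm.2 n h hn.1 hnm).elim
    · exact h
    · exact (hn.2 m h hm.1 hnm.symm).elim
  · rw [hT]
    ext y
    simp only [mem_ofPred_eq, mem_image, mem_sdiff, mem_iUnion, mem_inter_iff, not_exists, not_and,
      mem_Iio]
    constructor
    · intro h
      classical
      refine ⟨Nat.find h, ⟨(Nat.find_spec h).1, fun m hm hmA hmv => ?_⟩, (Nat.find_spec h).2.symm⟩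
      exact Nat.find_min h hm ⟨hmA, (Nat.find_spec h).2.trans hmv.symm⟩
    · rintro ⟨n, ⟨hn, -⟩, rfl⟩
      exact ⟨n, hn, rfl⟩

theorem measurable_encard (hT : IsMeasurablyEnumerated T) : Measurable fun ω => (T ω).encard := by
  obtain ⟨v, D, -, hD, hT⟩ := hT.exists_injOn
  have h1 : Measurable fun ω => (((T ω).encard : ℕ∞) : ℝ≥0∞) := by
    have : (fun ω => (((T ω).encard : ℕ∞) : ℝ≥0∞)) = fun ω => ∑' n, (D n).indicator 1 ω := by
      funext ω
      rw [(hT ω).2, (hT ω).1.encard_image, ← Measure.count_apply .of_discrete,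
        ← lintegral_indicator_one .of_discrete, lintegral_count]
      rfl
    rw [this]
    exact Measurable.tsum fun n => measurable_one.indicator (hD n)
  refine measurable_to_countable' fun x => ?_
  convert h1 (measurableSet_singleton (x : ℝ≥0∞)) using 1
  ext ω
  simp

theorem measurable_tsum (hT : IsMeasurablyEnumerated T) {f : ℝ → ℝ} (hf : Measurable f) :
    Measurable fun ω => ∑' x : ↥(T ω), f x := by
  obtain ⟨v, D, hv, hD, hT⟩ := hT.exists_injOn
  have key : ∀ ω, ∑' x : ↥(T ω), f x = ∑' n, (D n).indicator (fun ω => f (v n ω)) ω := by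
    intro ω
    rw [(hT ω).2, tsum_image f (hT ω).1, tsum_subtype {n | ω ∈ D n} fun n => f (v n ω)]
    rfl
  simp_rw [key]
  exact Measurable.tsum fun n => (hf.comp (hv n)).indicator (hD n)

end IsMeasurablyEnumerated

theorem isMeasurablyEnumerated_spacingsBelowOne {Ω : Type*} [MeasurableSpace Ω] {S : Ω → Set ℝ}
    (hS : ∀ B : Set ℝ, MeasurableSet B → MeasurableSet {ω | (S ω ∩ B).Nonempty}) :
    IsMeasurablyEnumerated fun ω => spacingsBelowOne (S ω) := by
  refine .of_denumerable (ι := Option ℤ)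
    (fun o ω => o.elim (1 - labelledPoint (S ω) 1)
      fun k => labelledPoint (S ω) k - labelledPoint (S ω) (k + 1))
    (fun o => {_ω | o.elim True fun k => 1 ≤ k}) ?_ (fun _ => MeasurableSet.const _) fun ω => ?_
  · rintro (_ | k)
    · exact measurable_const.sub (measurable_labelledPoint hS _)
    · exact (measurable_labelledPoint hS _).sub (measurable_labelledPoint hS _)
  · ext y
    simp [spacingsBelowOne, Option.exists]

theorem isMeasurablyEnumerated_smallSpacings {Ω : Type*} [MeasurableSpace Ω] {S : Ω → Set ℝ}
    (hS : ∀ B : Set ℝ, MeasurableSet B → MeasurableSet {ω | (S ω ∩ B).Nonempty}) :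
    IsMeasurablyEnumerated fun ω => smallSpacings (S ω) := by
  refine .of_denumerable (ι := ℤ) (fun k ω => spacing (S ω) k) (fun k => {ω | spacing (S ω) k < 1})
    (measurable_spacing hS) (fun k => measurableSet_lt (measurable_spacing hS k) measurable_const)
    fun ω => ?_
  ext y
  simp [smallSpacings, and_comm]

theorem IsPoissonProcess.measurableSet_nonempty {Ω : Type*} [MeasurableSpace Ω] {E : Type*}
    [MeasurableSpace E] {N : Ω → Set E} {Λ : Measure E} {P : Measure Ω}
    (h : IsPoissonProcess N Λ P) {B : Set E} (hB : MeasurableSet B) :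
    MeasurableSet {ω | (N ω ∩ B).Nonempty} := by
  simp_rw [← Set.encard_ne_zero]
  exact h.measurable_count B hB (MeasurableSet.of_discrete (s := {0}ᶜ))

/-! ### The intensity measure -/

theorem scaleInvariantIntensity_apply (θ : ℝ) {B : Set ℝ} (hB : MeasurableSet B) :
    scaleInvariantIntensity θ B = ∫⁻ x in B ∩ Ioi 0, ENNReal.ofReal (θ / x) := by
  rw [scaleInvariantIntensity, withDensity_apply _ hB, Measure.restrict_restrict hB]

theorem scaleInvariantIntensity_Ico_le {θ : ℝ} (hθ : 0 ≤ θ) {a b : ℝ} (ha : 0 < a) :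
    scaleInvariantIntensity θ (Ico a b) ≤ ENNReal.ofReal (θ / a) * ENNReal.ofReal (b - a) := by
  have hs : MeasurableSet (Ico a b ∩ Ioi 0) := measurableSet_Ico.inter measurableSet_Ioi
  calc scaleInvariantIntensity θ (Ico a b)
      = ∫⁻ x in Ico a b ∩ Ioi 0, ENNReal.ofReal (θ / x) :=
        scaleInvariantIntensity_apply θ measurableSet_Ico
    _ ≤ ∫⁻ _ in Ico a b ∩ Ioi 0, ENNReal.ofReal (θ / a) := by
        refine setLIntegral_mono measurable_const fun x hx => ENNReal.ofReal_le_ofReal ?_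
        have := hx.1.1
        gcongr
    _ = ENNReal.ofReal (θ / a) * volume (Ico a b ∩ Ioi 0) := by simp
    _ ≤ ENNReal.ofReal (θ / a) * ENNReal.ofReal (b - a) := by
        rw [← Real.volume_Ico]
        gcongr
        exact inter_subset_left

theorem scaleInvariantIntensity_Ico_ne_top {θ : ℝ} (hθ : 0 ≤ θ) {a b : ℝ} (ha : 0 < a) :
    scaleInvariantIntensity θ (Ico a b) ≠ ∞ :=
  ((scaleInvariantIntensity_Ico_le hθ ha).trans_lt
    (ENNReal.mul_lt_top ENNReal.ofReal_lt_top ENNReal.ofReal_lt_top)).ne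

theorem scaleInvariantIntensity_Iic_zero (θ : ℝ) : scaleInvariantIntensity θ (Iic 0) = 0 := by
  rw [scaleInvariantIntensity_apply θ measurableSet_Iic, Iic_inter_Ioi, Ioc_self]
  simp

/-- Ensures almost surely infinitely many points above `1`, so that every `pointAboveOne` is a
genuine point. -/
theorem scaleInvariantIntensity_Ici_one {θ : ℝ} (hθ : 0 < θ) :
    scaleInvariantIntensity θ (Ici 1) = ∞ := by
  have hs : Ici (1 : ℝ) ∩ Ioi 0 = Ici 1 :=
    inter_eq_left.2 fun x hx => mem_Ioi.2 (one_pos.trans_le (mem_Ici.1 hx))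
  rw [scaleInvariantIntensity_apply θ measurableSet_Ici, hs]
  by_contra h
  have hm : Measurable fun x : ℝ => θ / x := measurable_const.div measurable_id
  have h1 : IntegrableOn (fun x : ℝ => θ / x) (Ici 1) := by
    refine ⟨hm.aestronglyMeasurable, ?_⟩
    rw [hasFiniteIntegral_iff_ofReal]
    · exact lt_top_iff_ne_top.2 h
    · filter_upwards [ae_restrict_mem measurableSet_Ici] with x hx
      exact div_nonneg hθ.le (zero_le_one.trans hx)
  refine not_integrableOn_Ici_inv (a := 1) ((h1.const_mul θ⁻¹).congr ?_)
  refine Filter.Eventually.of_forall fun x => ?_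
  simp only
  field_simp

/-! ### Poisson estimates -/

theorem tsum_poissonMeasure_singleton (r : ℝ≥0) : ∑' n, poissonMeasure r {n} = 1 := by
  have h := lintegral_countable' (μ := poissonMeasure r) (fun _ : ℕ => (1 : ℝ≥0∞))
  simpa using h.symm

/-- The ratio of the two masses is `r / (n + 1)`. Summing over `n` gives mass at most `r` on `n ≥
1`. -/
theorem poissonMeasure_singleton_succ_le (r : ℝ≥0) (n : ℕ) :
    poissonMeasure r {n + 1} ≤ r * poissonMeasure r {n} := by
  rw [poissonMeasure_singleton, poissonMeasure_singleton, ← ENNReal.ofReal_coe_nnreal,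
    ← ENNReal.ofReal_mul r.coe_nonneg]
  refine ENNReal.ofReal_le_ofReal ?_
  rw [Nat.factorial_succ]
  push_cast
  calc Real.exp (-r) * r ^ (n + 1) / ((n + 1) * (n.factorial : ℝ))
      ≤ Real.exp (-r) * r ^ (n + 1) / (1 * (n.factorial : ℝ)) := by
        gcongr
        linarith [n.cast_nonneg (α := ℝ)]
    _ = r * (Real.exp (-r) * r ^ n / (n.factorial : ℝ)) := by ring

/-- Cancelling against the factorial leaves `(n + 2) / (n + 1) ≤ 2`. Summing bounds the second
moment restricted to counts of at least two by `2 r²`. -/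
theorem poissonMeasure_singleton_add_two_mul_sq_le (r : ℝ≥0) (n : ℕ) :
    poissonMeasure r {n + 2} * ((n + 2 : ℕ) : ℝ≥0∞) ^ 2 ≤ 2 * r ^ 2 * poissonMeasure r {n} := by
  rw [poissonMeasure_singleton, poissonMeasure_singleton, ← ENNReal.ofReal_coe_nnreal,
    ← ENNReal.ofReal_natCast, ← ENNReal.ofReal_pow (Nat.cast_nonneg _),
    ← ENNReal.ofReal_mul (by positivity), ← ENNReal.ofReal_pow r.coe_nonneg,
    show (2 : ℝ≥0∞) = ENNReal.ofReal 2 by simp,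
    ← ENNReal.ofReal_mul (by positivity), ← ENNReal.ofReal_mul (by positivity)]
  refine ENNReal.ofReal_le_ofReal ?_
  rw [Nat.factorial_succ, Nat.factorial_succ]
  push_cast
  have hn : (0 : ℝ) ≤ n := n.cast_nonneg
  have hf : (0 : ℝ) < n.factorial := by positivity
  have h : ((n : ℝ) + 2) ≤ 2 * (n + 1) := by linarith
  have key : Real.exp (-r) * r ^ (n + 2) / ((n + 1 + 1) * ((n + 1) * (n.factorial : ℝ)))
      * ((n : ℝ) + 2) ^ 2
      = Real.exp (-r) * r ^ (n + 2) / (n.factorial : ℝ) * ((n + 2) / (n + 1)) := by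
    field_simp
    ring
  rw [key]
  calc _ ≤ Real.exp (-r) * r ^ (n + 2) / (n.factorial : ℝ) * 2 := by
        gcongr
        rw [div_le_iff₀ (by positivity)]
        exact h
    _ = _ := by ring

namespace IsPoissonProcess

variable {Ω : Type*} [MeasurableSpace Ω] {E : Type*} [MeasurableSpace E] {N : Ω → Set E}
  {Λ : Measure E} {P : Measure Ω} {B : Set E}

theorem lintegral_comp_count (h : IsPoissonProcess N Λ P) (hB : MeasurableSet B) (hΛ : Λ B ≠ ∞)
    (φ : ℕ∞ → ℝ≥0∞) : ∫⁻ ω, φ (N ω ∩ B).encard ∂P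
      = ∑' n : ℕ, poissonMeasure (Λ B).toNNReal {n} * φ n := by
  rw [← lintegral_map (f := φ) .of_discrete (h.measurable_count B hB), h.count_law B hB hΛ,
    lintegral_map .of_discrete .of_discrete, lintegral_countable']
  simp_rw [mul_comm]

theorem measure_nonempty_le (h : IsPoissonProcess N Λ P) (hB : MeasurableSet B) (hΛ : Λ B ≠ ∞) :
    ∫⁻ ω, (if (N ω ∩ B).encard = 0 then 0 else 1) ∂P ≤ Λ B := by
  rw [h.lintegral_comp_count hB hΛ (fun n => if n = 0 then 0 else 1),
    tsum_eq_zero_add' ENNReal.summable]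
  calc _ = ∑' n : ℕ, poissonMeasure (Λ B).toNNReal {n + 1} := by simp
    _ ≤ ∑' n : ℕ, (Λ B).toNNReal * poissonMeasure (Λ B).toNNReal {n} :=
        ENNReal.tsum_le_tsum fun n => poissonMeasure_singleton_succ_le _ n
    _ = Λ B := by
        rw [ENNReal.tsum_mul_left, tsum_poissonMeasure_singleton, mul_one, ENNReal.coe_toNNReal hΛ]

theorem lintegral_count_sq_of_two_le_le (h : IsPoissonProcess N Λ P) (hB : MeasurableSet B)
    (hΛ : Λ B ≠ ∞) :
    ∫⁻ ω, (if (N ω ∩ B).encard ≤ 1 then 0 else ((N ω ∩ B).encard : ℝ≥0∞) ^ 2) ∂P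
      ≤ 2 * Λ B ^ 2 := by
  rw [h.lintegral_comp_count hB hΛ (fun n => if n ≤ 1 then 0 else (n : ℝ≥0∞) ^ 2),
    tsum_eq_zero_add' ENNReal.summable, tsum_eq_zero_add' ENNReal.summable]
  calc _ = ∑' n : ℕ, poissonMeasure (Λ B).toNNReal {n + 2} * ((n + 2 : ℕ) : ℝ≥0∞) ^ 2 := by
        have h2 : ∀ n : ℕ, ¬ (((n + 1 + 1 : ℕ) : ℕ∞) ≤ 1) := fun n => by
          rw [show (1 : ℕ∞) = ((1 : ℕ) : ℕ∞) from rfl, Nat.cast_le]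
          omega
        simp only [h2, if_false]
        simp [add_assoc, one_add_one_eq_two]
    _ ≤ ∑' n : ℕ, 2 * (Λ B).toNNReal ^ 2 * poissonMeasure (Λ B).toNNReal {n} :=
        ENNReal.tsum_le_tsum fun n => poissonMeasure_singleton_add_two_mul_sq_le _ n
    _ = 2 * Λ B ^ 2 := by
        rw [ENNReal.tsum_mul_left, tsum_poissonMeasure_singleton, mul_one, ENNReal.coe_toNNReal hΛ]

theorem ae_finite (h : IsPoissonProcess N Λ P) (hB : MeasurableSet B) (hΛ : Λ B ≠ ∞) :
    ∀ᵐ ω ∂P, (N ω ∩ B).Finite := by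
  -- The indicator of `⊤` vanishes at every natural number, so its integral is zero.
  have h1 := h.lintegral_comp_count hB hΛ (fun n => if n = ⊤ then 1 else 0)
  simp only [ENat.natCast_ne_top, if_false, mul_zero, tsum_zero] at h1
  replace h1 := (lintegral_eq_zero_iff (Measurable.comp
    (g := fun n : ℕ∞ => if n = ⊤ then (1 : ℝ≥0∞) else 0) .of_discrete (h.measurable_count B hB))).1 h1
  filter_upwards [h1] with ω hω
  rw [← encard_ne_top_iff]
  intro h2
  simp [h2] at hω

theorem ae_eq_empty (h : IsPoissonProcess N Λ P) (hB : MeasurableSet B) (hΛ : Λ B = 0) :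
    ∀ᵐ ω ∂P, N ω ∩ B = ∅ := by
  have h1 := h.measure_nonempty_le hB (by simp [hΛ])
  rw [hΛ, nonpos_iff_eq_zero] at h1
  replace h1 := (lintegral_eq_zero_iff (Measurable.comp
    (g := fun n : ℕ∞ => if n = 0 then (0 : ℝ≥0∞) else 1) .of_discrete (h.measurable_count B hB))).1 h1
  filter_upwards [h1] with ω hω
  by_contra h2
  have h3 : (N ω ∩ B).encard ≠ 0 := by simpa using h2
  simp [h3] at hω

end IsPoissonProcess

/-! ### Second moment of a sum with short-range dependence -/

/-- Expand the square over pairs. Pairs at distance at least two factor by independence; for the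
others `F i * F j ≤ F i ^ 2 + F j ^ 2`. Each index has at most three such partners, and the two
squares give the factor `3 + 3 = 6`. -/
theorem lintegral_tsum_sq_le {Ω : Type*} [MeasurableSpace Ω] {P : Measure Ω}
    {F : ℕ → Ω → ℝ≥0∞} {a : ℕ → ℝ≥0∞} (hF : ∀ i, Measurable (F i))
    (h1 : ∀ i, ∫⁻ ω, F i ω ∂P ≤ a i) (h2 : ∀ i, ∫⁻ ω, F i ω ^ 2 ∂P ≤ a i)
    (hind : ∀ i j, i + 2 ≤ j → IndepFun (F i) (F j) P) :
    ∫⁻ ω, (∑' i, F i ω) ^ 2 ∂P ≤ (∑' i, a i) ^ 2 + 6 * ∑' i, a i := by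
  have hfar : ∀ i j, i + 2 ≤ j → ∫⁻ ω, F i ω * F j ω ∂P ≤ a i * a j := fun i j hij => by
    calc _ = (∫⁻ ω, F i ω ∂P) * ∫⁻ ω, F j ω ∂P :=
          lintegral_mul_eq_lintegral_mul_lintegral_of_indepFun (hF i) (hF j) (hind i j hij)
      _ ≤ _ := mul_le_mul' (h1 i) (h1 j)
  have hnear : ∀ i j, ∫⁻ ω, F i ω * F j ω ∂P ≤ a i + a j := fun i j => by
    calc _ ≤ ∫⁻ ω, F i ω ^ 2 + F j ω ^ 2 ∂P := by
          refine lintegral_mono fun ω => ?_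
          rcases le_total (F i ω) (F j ω) with h | h
          · exact (mul_le_mul_left h _).trans ((sq (F j ω)).ge.trans le_add_self)
          · exact (mul_le_mul_right h _).trans ((sq (F i ω)).ge.trans le_self_add)
      _ = ∫⁻ ω, F i ω ^ 2 ∂P + ∫⁻ ω, F j ω ^ 2 ∂P := lintegral_add_left ((hF i).pow_const 2) _
      _ ≤ _ := add_le_add (h2 i) (h2 j)
  let d : ℕ → ℕ → ℝ≥0∞ := fun i j => if i ≤ j + 1 ∧ j ≤ i + 1 then 1 else 0
  have hd : ∀ i, ∑' j, d i j ≤ 3 := fun i => by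
    rw [tsum_eq_sum (s := Finset.Icc (i - 1) (i + 1))]
    · calc _ ≤ ∑ j ∈ Finset.Icc (i - 1) (i + 1), (1 : ℝ≥0∞) :=
            Finset.sum_le_sum fun j _ => by simp only [d]; split_ifs <;> simp
        _ = ((i + 1 + 1 - (i - 1) : ℕ) : ℝ≥0∞) := by simp
        _ ≤ ((3 : ℕ) : ℝ≥0∞) := by
            gcongr
            omega
        _ = 3 := by norm_num
    · intro j hj
      rw [Finset.mem_Icc] at hj
      exact if_neg (by omega)
  have hsymm : ∀ i j, d i j = d j i := fun i j => by simp only [d, and_comm]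
  have hpair : ∀ i j, ∫⁻ ω, F i ω * F j ω ∂P ≤ a i * a j + (a i * d i j + a j * d i j) := by
    intro i j
    by_cases h : i ≤ j + 1 ∧ j ≤ i + 1
    · simp only [d, if_pos h, mul_one]
      exact (hnear i j).trans le_add_self
    · refine le_trans ?_ le_self_add
      rcases le_total i j with hij | hij
      · exact hfar i j (by omega)
      · simp_rw [mul_comm (F i _), mul_comm (a i)]
        exact hfar j i (by omega)
  calc ∫⁻ ω, (∑' i, F i ω) ^ 2 ∂P = ∫⁻ ω, ∑' i, ∑' j, F i ω * F j ω ∂P := by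
        simp_rw [sq, ENNReal.tsum_mul_left, ENNReal.tsum_mul_right]
    _ = ∑' i, ∑' j, ∫⁻ ω, F i ω * F j ω ∂P := by
        refine (lintegral_tsum fun i =>
          (Measurable.tsum fun j => (hF i).mul (hF j)).aemeasurable).trans ?_
        refine tsum_congr fun i => lintegral_tsum fun j => ((hF i).mul (hF j)).aemeasurable
    _ ≤ ∑' i, ∑' j, (a i * a j + (a i * d i j + a j * d i j)) :=
        ENNReal.tsum_le_tsum fun i => ENNReal.tsum_le_tsum fun j => hpair i j
    _ = (∑' i, a i) ^ 2 + (∑' i, a i * ∑' j, d i j + ∑' j, a j * ∑' i, d j i) := by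
        simp_rw [ENNReal.tsum_add]
        rw [ENNReal.tsum_comm (f := fun i j => a j * d i j)]
        simp_rw [ENNReal.tsum_mul_left, ENNReal.tsum_mul_right, sq, fun i j => hsymm j i]
    _ ≤ (∑' i, a i) ^ 2 + (∑' i, a i * 3 + ∑' i, a i * 3) := by
        gcongr <;> exact hd _
    _ = (∑' i, a i) ^ 2 + 6 * ∑' i, a i := by
        rw [ENNReal.tsum_mul_right]
        ring

/-! ### Deterministic bounds on the symmetric difference -/

section Deterministic

variable {S : Set ℝ}

/-- Also covers the default `sSup ∅ = 0`, so the argument never needs points accumulating at `0`. -/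
theorem pointBelowOne_nonneg (hpos : S ⊆ Ioi 0) (n : ℕ) : 0 ≤ pointBelowOne S n := by
  cases n <;> exact Real.sSup_nonneg fun x hx => (mem_Ioi.1 (hpos hx.1)).le

theorem pointBelowOne_succ_le (hpos : S ⊆ Ioi 0) (n : ℕ) :
    pointBelowOne S (n + 1) ≤ pointBelowOne S n :=
  Real.sSup_le (fun _ hx => (mem_Iio.1 hx.2).le) (pointBelowOne_nonneg hpos n)

/-- Local finiteness keeps points from accumulating at `1`; inserting `1 / 2` makes the finite set
nonempty and dominates the remaining points. -/
theorem pointBelowOne_zero_lt_one (hfin : (S ∩ Ico (1 / 2) 1).Finite) : pointBelowOne S 0 < 1 := by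
  rcases (S ∩ Iio 1).eq_empty_or_nonempty with h | h
  · simp [pointBelowOne, h]
  · have hfin' := hfin.insert (1 / 2)
    refine lt_of_le_of_lt (csSup_le h fun x hx => ?_)
      ((hfin'.csSup_lt_iff (insert_nonempty _ _)).2 ?_ :
        sSup (insert (1 / 2) (S ∩ Ico (1 / 2) 1)) < 1)
    · rcases le_total x (1 / 2) with hx2 | hx2
      · exact hx2.trans (le_csSup hfin'.bddAbove (mem_insert _ _))
      · exact le_csSup hfin'.bddAbove (mem_insert_of_mem _ ⟨hx.1, hx2, hx.2⟩)
    · rintro x (rfl | hx)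
      · norm_num
      · exact hx.2.2

theorem pointBelowOne_lt_one (hpos : S ⊆ Ioi 0) (hfin : (S ∩ Ico (1 / 2) 1).Finite) (n : ℕ) :
    pointBelowOne S n < 1 := by
  induction n with
  | zero => exact pointBelowOne_zero_lt_one hfin
  | succ n ih => exact (pointBelowOne_succ_le hpos n).trans_lt ih

theorem labelledPoint_add_one (n : ℕ) : labelledPoint S (n + 1) = pointBelowOne S n := by
  simp [labelledPoint]

theorem labelledPoint_neg (n : ℕ) : labelledPoint S (-n) = pointAboveOne S n := by
  rw [labelledPoint, if_neg (by omega)]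
  simp

theorem spacing_neg (n : ℕ) : spacing S (-n) = pointAboveOne S (n + 1) - pointAboveOne S n := by
  rw [spacing, labelledPoint_neg, show (-(n : ℤ) - 1) = -((n + 1 : ℕ) : ℤ) by push_cast; ring,
    labelledPoint_neg]

theorem spacingsBelowOne_diff_smallSpacings_subset (hpos : S ⊆ Ioi 0)
    (hfin : (S ∩ Ico (1 / 2) 1).Finite) :
    spacingsBelowOne S \ smallSpacings S ⊆ {1 - labelledPoint S 1} := by
  rintro y ⟨rfl | ⟨k, hk, rfl⟩, h⟩
  · rfl
  · refine (h ⟨k + 1, ?_⟩).elim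
    obtain ⟨n, rfl⟩ : ∃ n : ℕ, k = n + 1 := ⟨(k - 1).toNat, by omega⟩
    have h1 := pointBelowOne_lt_one hpos hfin n
    have h2 := pointBelowOne_nonneg hpos (n + 1)
    have h3 := labelledPoint_add_one (S := S) (n + 1)
    push_cast at h3
    rw [spacing, add_sub_cancel_right, labelledPoint_add_one, h3]
    exact ⟨rfl, by linarith⟩

/-- The indices of the points of `S` above `1` that are within distance `1` of the next one. -/
def closePairs (S : Set ℝ) : Set ℕ := {n | pointAboveOne S (n + 1) - pointAboveOne S n < 1}

/-- Indices `k ≥ 2` give elements of `spacingsBelowOne S`, `k = 1` is the gap straddling `1`, and `k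
≤ 0` are gaps above `1`. -/
theorem smallSpacings_diff_spacingsBelowOne_subset :
    smallSpacings S \ spacingsBelowOne S
      ⊆ insert (spacing S 1) ((fun n : ℕ => spacing S (-n)) '' closePairs S) := by
  rintro y ⟨⟨k, rfl, hk⟩, h⟩
  rcases lt_trichotomy k 1 with h1 | rfl | h1
  · right
    obtain ⟨n, rfl⟩ : ∃ n : ℕ, k = -n := ⟨(-k).toNat, by omega⟩
    exact ⟨n, by rwa [spacing_neg] at hk, rfl⟩
  · left; rfl
  · refine (h (Or.inr ⟨k - 1, by omega, ?_⟩)).elim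
    rw [spacing, sub_add_cancel]

theorem encard_symmDiff_spacings_le (hpos : S ⊆ Ioi 0) (hfin : (S ∩ Ico (1 / 2) 1).Finite) :
    (symmDiff (spacingsBelowOne S) (smallSpacings S)).encard ≤ (closePairs S).encard + 2 := by
  calc _ ≤ (spacingsBelowOne S \ smallSpacings S).encard
        + (smallSpacings S \ spacingsBelowOne S).encard := encard_union_le _ _
    _ ≤ 1 + ((closePairs S).encard + 1) := by
        gcongr
        · exact (encard_le_encard (spacingsBelowOne_diff_smallSpacings_subset hpos hfin)).trans
            (encard_singleton _).le
        · refine (encard_le_encard smallSpacings_diff_spacingsBelowOne_subset).trans ?_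
          refine (encard_insert_le _ _).trans ?_
          gcongr
          exact encard_image_le _ _
    _ = _ := by ring

theorem finite_inter_Icc_of_finite_inter_Ico (hfin : ∀ j : ℕ, (S ∩ Ico (j + 1 : ℝ) (j + 2)).Finite)
    (b : ℝ) : (S ∩ Icc 1 b).Finite := by
  obtain ⟨m, hm⟩ := exists_nat_gt b
  refine ((finite_Iio m).biUnion fun j _ => hfin j).subset fun x hx => ?_
  have h1 := hx.2.1
  have h2 : (⌊x - 1⌋₊ : ℝ) ≤ x - 1 := Nat.floor_le (by linarith)
  have h3 : x - 1 < ⌊x - 1⌋₊ + 1 := Nat.lt_floor_add_one _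
  have h4 : ⌊x - 1⌋₊ < m := by
    have := hx.2.2
    exact_mod_cast (by linarith : (⌊x - 1⌋₊ : ℝ) < m)
  exact mem_biUnion h4 ⟨hx.1, by linarith, by linarith⟩

theorem sInf_mem_of_finite_inter_Icc (hfin : ∀ b, (S ∩ Icc 1 b).Finite) {T : Set ℝ}
    (hT : T ⊆ S ∩ Ici 1) (hne : T.Nonempty) : sInf T ∈ T := by
  obtain ⟨t, ht⟩ := hne
  have h1 : (T ∩ Iic t).Finite :=
    (hfin t).subset fun x hx => ⟨(hT hx.1).1, (hT hx.1).2, hx.2⟩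
  obtain ⟨a, ha, hmin⟩ := exists_min_image _ id h1 ⟨t, ht, self_mem_Iic⟩
  refine IsLeast.csInf_mem (a := a) ⟨ha.1, fun x hx => ?_⟩
  rcases le_total x t with h | h
  · exact hmin x ⟨hx, h⟩
  · exact (mem_Iic.1 ha.2).trans h

theorem pointAboveOne_mem (hfin : ∀ b, (S ∩ Icc 1 b).Finite) (hinf : (S ∩ Ici 1).Infinite)
    (n : ℕ) : pointAboveOne S n ∈ S ∩ Ici 1 ∧
      pointAboveOne S (n + 1) ∈ S ∩ Ioi (pointAboveOne S n) := by
  have hstep : ∀ a, 1 ≤ a → sInf (S ∩ Ioi a) ∈ S ∩ Ioi a := fun a ha => by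
    refine sInf_mem_of_finite_inter_Icc hfin
      (fun x hx => ⟨hx.1, ha.trans (mem_Ioi.1 hx.2).le⟩) ?_
    obtain ⟨x, hx, hxa⟩ := (hinf.sdiff (hfin a)).nonempty
    exact ⟨x, hx.1, not_le.1 fun h => hxa ⟨hx.1, hx.2, h⟩⟩
  induction n with
  | zero =>
    have h0 : pointAboveOne S 0 ∈ S ∩ Ici 1 :=
      sInf_mem_of_finite_inter_Icc hfin subset_rfl hinf.nonempty
    exact ⟨h0, hstep _ h0.2⟩
  | succ n ih =>
    have h1 : pointAboveOne S (n + 1) ∈ S ∩ Ici 1 :=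
      ⟨ih.2.1, (mem_Ici.1 ih.1.2).trans (mem_Ioi.1 ih.2.2).le⟩
    exact ⟨h1, hstep _ h1.2⟩

/-- A bound for the number of points of a block that are within distance `1` of the next point, when
the block has `n` points and the following block of the same length `1` has `m` points. -/
noncomputable def blockBound (n m : ℕ∞) : ℝ≥0∞ := if n = 1 ∧ m = 0 then 0 else n

/-- The upper point of a close pair starting in a block lies in that block or the next. A lone point
followed by an empty block thus starts no close pair. -/
theorem encard_closePairs_block_le (hfin : ∀ b, (S ∩ Icc 1 b).Finite) (hinf : (S ∩ Ici 1).Infinite)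
    (j : ℕ) : ((closePairs S ∩ {n | pointAboveOne S n ∈ Ico (j + 1 : ℝ) (j + 2)}).encard : ℝ≥0∞)
      ≤ blockBound (S ∩ Ico (j + 1 : ℝ) (j + 2)).encard
        (S ∩ Ico ((j + 1 : ℕ) + 1 : ℝ) ((j + 1 : ℕ) + 2)).encard := by
  have hmem := pointAboveOne_mem hfin hinf
  have hmono : StrictMono (pointAboveOne S) := strictMono_nat_of_lt_succ fun n => (hmem n).2.2
  set K := closePairs S ∩ {n | pointAboveOne S n ∈ Ico (j + 1 : ℝ) (j + 2)} with hK
  have hsub : pointAboveOne S '' K ⊆ S ∩ Ico (j + 1 : ℝ) (j + 2) := by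
    rintro _ ⟨n, hn, rfl⟩
    exact ⟨(hmem n).1.1, hn.2⟩
  rw [blockBound]
  split_ifs with h
  · obtain ⟨h1, h2⟩ := h
    obtain ⟨x, hx⟩ := encard_eq_one.1 h1
    have : K = ∅ := by
      refine eq_empty_of_forall_notMem fun n hn => ?_
      have hlt : pointAboveOne S n < pointAboveOne S (n + 1) := (hmem n).2.2
      have hclose : pointAboveOne S (n + 1) - pointAboveOne S n < 1 := hn.1
      have hlo : (j + 1 : ℝ) ≤ pointAboveOne S n := hn.2.1
      have hhi : pointAboveOne S n < (j + 2 : ℝ) := hn.2.2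
      rcases lt_or_ge (pointAboveOne S (n + 1)) (j + 2 : ℝ) with h3 | h3
      · have e1 : pointAboveOne S n ∈ ({x} : Set ℝ) := hx ▸ ⟨(hmem n).1.1, hlo, hhi⟩
        have e2 : pointAboveOne S (n + 1) ∈ ({x} : Set ℝ) :=
          hx ▸ ⟨(hmem n).2.1, by linarith, h3⟩
        rw [mem_singleton_iff] at e1 e2
        linarith
      · have : pointAboveOne S (n + 1) ∈ (∅ : Set ℝ) :=
          encard_eq_zero.1 h2 ▸ ⟨(hmem n).2.1, by push_cast; linarith, by push_cast; linarith⟩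
        exact this
    simp [this]
  · rw [← hmono.injective.encard_image]
    exact_mod_cast encard_le_encard hsub

theorem encard_closePairs_le (hfin : ∀ j : ℕ, (S ∩ Ico (j + 1 : ℝ) (j + 2)).Finite)
    (hinf : (S ∩ Ici 1).Infinite) : ((closePairs S).encard : ℝ≥0∞)
      ≤ ∑' j : ℕ, blockBound (S ∩ Ico (j + 1 : ℝ) (j + 2)).encard
        (S ∩ Ico ((j + 1 : ℕ) + 1 : ℝ) ((j + 1 : ℕ) + 2)).encard := by
  have hfin' := finite_inter_Icc_of_finite_inter_Ico hfin
  -- Passing to counting measure gives countable subadditivity over the blocks.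
  calc ((closePairs S).encard : ℝ≥0∞) = Measure.count (closePairs S) :=
        (Measure.count_apply .of_discrete).symm
    _ ≤ Measure.count
          (⋃ j : ℕ, closePairs S ∩ {n | pointAboveOne S n ∈ Ico (j + 1 : ℝ) (j + 2)}) := by
        refine measure_mono fun n hn => mem_iUnion.2 ⟨⌊pointAboveOne S n - 1⌋₊, hn, ?_⟩
        have h1 : 1 ≤ pointAboveOne S n := (pointAboveOne_mem hfin' hinf n).1.2
        have h2 : (⌊pointAboveOne S n - 1⌋₊ : ℝ) ≤ pointAboveOne S n - 1 :=
          Nat.floor_le (by linarith)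
        have h3 := Nat.lt_floor_add_one (pointAboveOne S n - 1)
        exact ⟨by linarith, by linarith⟩
    _ ≤ ∑' j : ℕ, Measure.count
          (closePairs S ∩ {n | pointAboveOne S n ∈ Ico (j + 1 : ℝ) (j + 2)}) :=
        measure_iUnion_le _
    _ ≤ _ := by
        refine ENNReal.tsum_le_tsum fun j => ?_
        rw [Measure.count_apply .of_discrete]
        exact encard_closePairs_block_le hfin' hinf j

end Deterministic

/-! ### Moments of the block contributions -/

/-- The value is `0` or at least `1`. Hence one bound serves for both first and second moments in
`lintegral_tsum_sq_le`. -/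
theorem blockBound_le_sq (n m : ℕ∞) : blockBound n m ≤ blockBound n m ^ 2 := by
  rw [blockBound]
  split_ifs
  · simp
  · rcases eq_or_ne n 0 with rfl | hn
    · simp
    · have : (1 : ℝ≥0∞) ≤ n := by exact_mod_cast Order.one_le_iff_pos.2 (pos_iff_ne_zero.2 hn)
      exact le_self_pow₀ this two_ne_zero

/-- The first term handles `n ≥ 2`; for `n = 1` the bound is nonzero only if `m ≠ 0`, which the
product detects. -/
theorem blockBound_sq_le (n m : ℕ∞) : blockBound n m ^ 2 ≤ (if n ≤ 1 then 0 else (n : ℝ≥0∞) ^ 2)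
    + (if n = 0 then 0 else 1) * (if m = 0 then 0 else 1) := by
  rw [blockBound]
  rcases eq_or_ne n 0 with rfl | hn
  · simp
  rcases eq_or_ne n 1 with rfl | hn1
  · by_cases hm : m = 0 <;> simp [hm]
  · have h : ¬ n ≤ 1 := fun h => by
      rcases (Order.le_one_iff.1 h) with h | h
      exacts [hn h, hn1 h]
    simp [h, hn1]

theorem pairwise_disjoint_Ico_add_one_add_two :
    Pairwise fun i j : ℕ => Disjoint (Ico (i + 1 : ℝ) (i + 2)) (Ico (j + 1 : ℝ) (j + 2)) := by
  have key : ∀ i j : ℕ, i < j → Disjoint (Ico (i + 1 : ℝ) (i + 2)) (Ico (j + 1 : ℝ) (j + 2)) := by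
    intro i j hij
    have : (i + 1 : ℝ) ≤ j := by exact_mod_cast hij
    refine disjoint_left.2 fun x hx hx' => ?_
    linarith [hx.2, hx'.1]
  intro i j hij
  rcases lt_or_gt_of_ne hij with h | h
  exacts [key i j h, (key j i h).symm]

/-- The summand `2` stands for the exceptional elements `1 - X₁` and `Y₁`. -/
theorem ENNReal.add_two_sq_le (x : ℝ≥0∞) : (x + 2) ^ 2 ≤ 2 * x ^ 2 + 8 := by
  rcases eq_or_ne x ∞ with rfl | hx
  · simp
  · lift x to ℝ≥0 using hx
    have h := add_sq_le (a := x) (b := 2)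
    rw [mul_add, show (2 : ℝ≥0) * 2 ^ 2 = 8 by norm_num] at h
    exact_mod_cast h

/-- A summable bound for the second moment of the number of close pairs with smaller point
in `[j + 1, j + 2)`. -/
noncomputable def blockMoment (θ : ℝ) (j : ℕ) : ℝ≥0∞ := 3 * ENNReal.ofReal (θ / (j + 1)) ^ 2

theorem tsum_blockMoment_ne_top {θ : ℝ} (hθ : 0 ≤ θ) : ∑' j, blockMoment θ j ≠ ∞ := by
  unfold blockMoment
  rw [ENNReal.tsum_mul_left]
  refine ENNReal.mul_ne_top (by simp) ?_
  have h : ∀ j : ℕ, ENNReal.ofReal (θ / (j + 1)) ^ 2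
      = ENNReal.ofReal (θ ^ 2 * (1 / ((j + 1 : ℕ) : ℝ) ^ 2)) := fun j => by
    rw [← ENNReal.ofReal_pow (by positivity)]
    congr 1
    push_cast
    field_simp
  simp_rw [h]
  exact (((summable_nat_add_iff 1).2
    (Real.summable_one_div_nat_pow.2 one_lt_two)).mul_left (θ ^ 2)).tsum_ofReal_ne_top

/-- A bound for the second moment of the number of close pairs above `1`. -/
noncomputable def closePairsMoment (θ : ℝ) : ℝ≥0∞ := (∑' j, blockMoment θ j) ^ 2 + 6 * ∑' j, blockMoment θ j

theorem closePairsMoment_ne_top {θ : ℝ} (hθ : 0 ≤ θ) : closePairsMoment θ ≠ ∞ :=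
  ENNReal.add_ne_top.2 ⟨ENNReal.pow_ne_top (tsum_blockMoment_ne_top hθ),
    ENNReal.mul_ne_top (by simp) (tsum_blockMoment_ne_top hθ)⟩

namespace IsPoissonProcess

variable {Ω : Type*} [MeasurableSpace Ω] {P : Measure Ω} {X : Ω → Set ℝ} {θ : ℝ}

theorem lintegral_blockBound_sq_le (hθ : 0 ≤ θ)
    (h : IsPoissonProcess X (scaleInvariantIntensity θ) P) (j : ℕ) :
    ∫⁻ ω, blockBound (X ω ∩ Ico (j + 1 : ℝ) (j + 2)).encard
      (X ω ∩ Ico ((j + 1 : ℕ) + 1 : ℝ) ((j + 1 : ℕ) + 2)).encard ^ 2 ∂P ≤ blockMoment θ j := by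
  let b : ℕ → Set ℝ := fun i => Ico (i + 1 : ℝ) (i + 2)
  have hb : ∀ i, MeasurableSet (b i) := fun i => measurableSet_Ico
  have hm : ∀ i, Measurable fun ω => (X ω ∩ b i).encard := fun i => h.measurable_count _ (hb i)
  have hΛ : ∀ i, scaleInvariantIntensity θ (b i) ≠ ∞ := fun i =>
    scaleInvariantIntensity_Ico_ne_top hθ (by positivity)
  have hle : ∀ i, j ≤ i → scaleInvariantIntensity θ (b i) ≤ ENNReal.ofReal (θ / (j + 1)) := by
    intro i hi
    refine (scaleInvariantIntensity_Ico_le hθ (by positivity)).trans ?_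
    rw [show (i + 2 : ℝ) - (i + 1) = 1 by ring, ENNReal.ofReal_one, mul_one]
    gcongr
  have hbd : ∀ ω, blockBound (X ω ∩ b j).encard (X ω ∩ b (j + 1)).encard ^ 2
      ≤ (if (X ω ∩ b j).encard ≤ 1 then 0 else ((X ω ∩ b j).encard : ℝ≥0∞) ^ 2)
      + (if (X ω ∩ b j).encard = 0 then 0 else 1) * (if (X ω ∩ b (j + 1)).encard = 0 then 0 else 1)
    := fun ω => blockBound_sq_le _ _
  have hφ : Measurable fun n : ℕ∞ => if n = 0 then (0 : ℝ≥0∞) else 1 := .of_discrete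
  have hψ : Measurable fun n : ℕ∞ => if n ≤ 1 then (0 : ℝ≥0∞) else (n : ℝ≥0∞) ^ 2 := .of_discrete
  have hind : IndepFun (fun ω => (X ω ∩ b j).encard) (fun ω => (X ω ∩ b (j + 1)).encard) P := by
    have := h.indep_count 2 (fun k => b (![j, j + 1] k)) (fun _ => hb _) (fun k l hkl =>
      pairwise_disjoint_Ico_add_one_add_two fun heq => hkl (by
        fin_cases k <;> fin_cases l <;> simp_all))
    exact this.indepFun (i := 0) (j := 1) (by decide)
  calc _ ≤ ∫⁻ ω, (if (X ω ∩ b j).encard ≤ 1 then 0 else ((X ω ∩ b j).encard : ℝ≥0∞) ^ 2)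
      + (if (X ω ∩ b j).encard = 0 then 0 else 1)
        * (if (X ω ∩ b (j + 1)).encard = 0 then 0 else 1) ∂P := lintegral_mono hbd
    _ = ∫⁻ ω, (if (X ω ∩ b j).encard ≤ 1 then 0 else ((X ω ∩ b j).encard : ℝ≥0∞) ^ 2) ∂P
      + ∫⁻ ω, (if (X ω ∩ b j).encard = 0 then 0 else 1)
        * (if (X ω ∩ b (j + 1)).encard = 0 then 0 else 1) ∂P :=
        lintegral_add_left (hψ.comp (hm j)) _
    _ = ∫⁻ ω, (if (X ω ∩ b j).encard ≤ 1 then 0 else ((X ω ∩ b j).encard : ℝ≥0∞) ^ 2) ∂P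
      + (∫⁻ ω, (if (X ω ∩ b j).encard = 0 then 0 else 1) ∂P)
        * ∫⁻ ω, (if (X ω ∩ b (j + 1)).encard = 0 then 0 else 1) ∂P := by
        congr 1
        exact lintegral_mul_eq_lintegral_mul_lintegral_of_indepFun (hφ.comp (hm j))
          (hφ.comp (hm (j + 1))) (hind.comp hφ hφ)
    -- The next block has an even smaller bound on its mean; `2 + 1` gives the factor `3` in
    -- `blockMoment`.
    _ ≤ 2 * ENNReal.ofReal (θ / (j + 1)) ^ 2
        + ENNReal.ofReal (θ / (j + 1)) * ENNReal.ofReal (θ / (j + 1)) := by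
        gcongr
        · refine (h.lintegral_count_sq_of_two_le_le (hb j) (hΛ j)).trans ?_
          gcongr
          exact hle j le_rfl
        · exact (h.measure_nonempty_le (hb j) (hΛ j)).trans (hle j le_rfl)
        · exact (h.measure_nonempty_le (hb (j + 1)) (hΛ (j + 1))).trans (hle (j + 1) (by omega))
    _ = blockMoment θ j := by
        rw [blockMoment]
        ring

theorem lintegral_tsum_blockBound_sq_le (hθ : 0 ≤ θ)
    (h : IsPoissonProcess X (scaleInvariantIntensity θ) P) :
    ∫⁻ ω, (∑' j : ℕ, blockBound (X ω ∩ Ico (j + 1 : ℝ) (j + 2)).encard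
      (X ω ∩ Ico ((j + 1 : ℕ) + 1 : ℝ) ((j + 1 : ℕ) + 2)).encard) ^ 2 ∂P
        ≤ closePairsMoment θ := by
  let b : ℕ → Set ℝ := fun i => Ico (i + 1 : ℝ) (i + 2)
  have hm : ∀ i, Measurable fun ω => (X ω ∩ b i).encard := fun i =>
    h.measurable_count _ measurableSet_Ico
  have hβ : Measurable fun p : ℕ∞ × ℕ∞ => blockBound p.1 p.2 := .of_discrete
  refine lintegral_tsum_sq_le
    (fun j => hβ.comp ((hm j).prodMk (hm (j + 1))))
    (fun j => (lintegral_mono fun ω => blockBound_le_sq _ _).trans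
      (h.lintegral_blockBound_sq_le hθ j)) (h.lintegral_blockBound_sq_le hθ) fun i j hij => ?_
  -- As `i + 2 ≤ j`, the four blocks are distinct, so the two pairs of counts are independent.
  have h4 := h.indep_count 4 (fun k => b (![i, i + 1, j, j + 1] k))
    (fun _ => measurableSet_Ico) (fun k l hkl =>
      pairwise_disjoint_Ico_add_one_add_two fun heq => hkl (by
        fin_cases k <;> fin_cases l <;> simp at heq ⊢ <;> omega))
  exact (h4.indepFun_prodMk_prodMk (fun _ => hm _) 0 1 2 3 (by decide) (by decide) (by decide)
    (by decide)).comp hβ hβ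

theorem ae_encard_symmDiff_spacings_le (hθ : 0 < θ)
    (h : IsPoissonProcess X (scaleInvariantIntensity θ) P) :
    ∀ᵐ ω ∂P, ((symmDiff (spacingsBelowOne (X ω)) (smallSpacings (X ω))).encard : ℝ≥0∞)
      ≤ ∑' j : ℕ, blockBound (X ω ∩ Ico (j + 1 : ℝ) (j + 2)).encard
        (X ω ∩ Ico ((j + 1 : ℕ) + 1 : ℝ) ((j + 1 : ℕ) + 2)).encard + 2 := by
  filter_upwards [h.ae_eq_empty measurableSet_Iic (scaleInvariantIntensity_Iic_zero θ),
    h.ae_finite (B := Ico (1 / 2) 1) measurableSet_Ico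
      (scaleInvariantIntensity_Ico_ne_top hθ.le one_half_pos),
    h.count_eq_top _ measurableSet_Ici (scaleInvariantIntensity_Ici_one hθ),
    ae_all_iff.2 fun j : ℕ => h.ae_finite (B := Ico (j + 1 : ℝ) (j + 2)) measurableSet_Ico
      (scaleInvariantIntensity_Ico_ne_top hθ.le (by positivity))] with ω h1 h2 h3 h4
  have hpos : X ω ⊆ Ioi 0 := fun x hx => mem_Ioi.2 <| not_le.1 fun hx0 =>
    (h1 ▸ (⟨hx, mem_Iic.2 hx0⟩ : x ∈ X ω ∩ Iic 0) : x ∈ (∅ : Set ℝ))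
  calc _ ≤ (((closePairs (X ω)).encard + 2 : ℕ∞) : ℝ≥0∞) := by
        exact_mod_cast encard_symmDiff_spacings_le hpos h2
    _ = ((closePairs (X ω)).encard : ℝ≥0∞) + 2 := by simp
    _ ≤ _ := by
        gcongr
        exact encard_closePairs_le h4 (encard_eq_top_iff.1 h3)

theorem lintegral_encard_symmDiff_spacings_sq_le [IsProbabilityMeasure P] (hθ : 0 < θ)
    (h : IsPoissonProcess X (scaleInvariantIntensity θ) P) :
    ∫⁻ ω, ((symmDiff (spacingsBelowOne (X ω)) (smallSpacings (X ω))).encard : ℝ≥0∞) ^ 2 ∂P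
      ≤ 2 * closePairsMoment θ + 8 := by
  calc _ ≤ ∫⁻ ω, 2 * (∑' j : ℕ, blockBound (X ω ∩ Ico (j + 1 : ℝ) (j + 2)).encard
        (X ω ∩ Ico ((j + 1 : ℕ) + 1 : ℝ) ((j + 1 : ℕ) + 2)).encard) ^ 2 + 8 ∂P := by
        refine lintegral_mono_ae ?_
        filter_upwards [h.ae_encard_symmDiff_spacings_le hθ] with ω hω
        exact (pow_le_pow_left₀ zero_le hω 2).trans (ENNReal.add_two_sq_le _)
    _ = 2 * ∫⁻ ω, (∑' j : ℕ, blockBound (X ω ∩ Ico (j + 1 : ℝ) (j + 2)).encard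
        (X ω ∩ Ico ((j + 1 : ℕ) + 1 : ℝ) ((j + 1 : ℕ) + 2)).encard) ^ 2 ∂P + 8 := by
        rw [lintegral_add_right _ measurable_const, lintegral_const_mul' _ _ (by simp)]
        simp
    _ ≤ _ := by
        gcongr
        exact h.lintegral_tsum_blockBound_sq_le hθ.le

end IsPoissonProcess

/-! ### Sums over two sets with finite symmetric difference -/

section SumDifference

variable {V W : Set ℝ}

theorem indicator_sub_indicator_eq_sdiff (f : ℝ → ℝ) :
    V.indicator f - W.indicator f = (V \ W).indicator f - (W \ V).indicator f := by
  classical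
  funext x
  by_cases hV : x ∈ V <;> by_cases hW : x ∈ W <;> simp [hV, hW, indicator]

theorem summable_indicator_of_finite {S : Set ℝ} (hS : S.Finite) (f : ℝ → ℝ) :
    Summable (S.indicator f) :=
  summable_of_hasFiniteSupport (hS.subset fun x hx => by
    by_contra h
    exact hx (indicator_of_notMem h _))

/-- The difference of the two indicator functions has finite support, so adding or subtracting it
preserves summability. -/
theorem summable_subtype_iff_of_finite_symmDiff (h : (symmDiff V W).Finite) (f : ℝ → ℝ) :
    (Summable fun x : ↥V => f x) ↔ Summable fun x : ↥W => f x := by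
  have hd := (summable_indicator_of_finite (h.subset subset_union_left) f).sub
    (summable_indicator_of_finite (h.subset subset_union_right) f)
  have heq : (fun x => V.indicator f x - W.indicator f x)
      = fun x => (V \ W).indicator f x - (W \ V).indicator f x := indicator_sub_indicator_eq_sdiff f
  refine (summable_subtype_iff_indicator (f := f) (s := V)).trans
    (Iff.trans ?_ (summable_subtype_iff_indicator (f := f) (s := W)).symm)
  rw [← heq] at hd
  constructor
  · intro hV
    simpa using hV.sub hd
  · intro hW
    simpa using hW.add hd

theorem tsum_sub_tsum_eq_sumDifference (h : (symmDiff V W).Finite) {f : ℝ → ℝ}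
    (hV : Summable fun x : ↥V => f x) :
    ∑' x : ↥V, f x - ∑' x : ↥W, f x = sumDifference V W f := by
  have hW := (summable_subtype_iff_of_finite_symmDiff h f).1 hV
  have hV' : Summable (V.indicator f) := summable_subtype_iff_indicator.1 hV
  have hW' : Summable (W.indicator f) := summable_subtype_iff_indicator.1 hW
  rw [sumDifference, tsum_subtype, tsum_subtype, tsum_subtype, tsum_subtype,
    ← hV'.tsum_sub hW', ← (summable_indicator_of_finite (h.subset subset_union_left) f).tsum_sub
    (summable_indicator_of_finite (h.subset subset_union_right) f)]
  exact tsum_congr fun x => congrFun (indicator_sub_indicator_eq_sdiff f) x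

/-- Summability is not required, because a divergent `tsum` is `0`. -/
theorem enorm_tsum_le_encard_mul (S : Set ℝ) (f : ℝ → ℝ) :
    ‖∑' x : ↥S, f x‖ₑ ≤ S.encard * ⨆ x, ‖f x‖ₑ :=
  enorm_tsum_le_tsum_enorm.trans
    ((ENNReal.tsum_le_tsum fun x : ↥S => le_iSup (fun y => ‖f y‖ₑ) (x : ℝ)).trans
      (ENNReal.tsum_set_const _ _).le)

theorem enorm_sumDifference_le (V W : Set ℝ) (f : ℝ → ℝ) :
    ‖sumDifference V W f‖ₑ ≤ (symmDiff V W).encard * ⨆ x, ‖f x‖ₑ := by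
  have hcard : (symmDiff V W).encard = (V \ W).encard + (W \ V).encard :=
    encard_union_eq disjoint_sdiff_sdiff
  calc _ ≤ ‖∑' x : ↥(V \ W), f x‖ₑ + ‖∑' x : ↥(W \ V), f x‖ₑ := enorm_sub_le
    _ ≤ (V \ W).encard * (⨆ x, ‖f x‖ₑ) + (W \ V).encard * ⨆ x, ‖f x‖ₑ :=
        add_le_add (enorm_tsum_le_encard_mul _ f) (enorm_tsum_le_encard_mul _ f)
    _ = _ := by rw [hcard, ENat.toENNReal_add, add_mul]

theorem ofReal_sumDifference_sq_le (V W : Set ℝ) (f : ℝ → ℝ) :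
    ENNReal.ofReal (sumDifference V W f ^ 2)
      ≤ ((symmDiff V W).encard : ℝ≥0∞) ^ 2 * (⨆ x, ‖f x‖ₑ) ^ 2 := by
  rw [← sq_abs, ENNReal.ofReal_pow (abs_nonneg _), ← Real.enorm_eq_ofReal_abs, ← mul_pow]
  exact pow_le_pow_left₀ zero_le (enorm_sumDifference_le V W f) 2

end SumDifference

/-! ### Conclusion -/

theorem mainTheorem3 (θ : ℝ) (hθ : 0 < θ) :
    ∃ C : ℝ≥0, ∀ (Ω : Type*) [MeasurableSpace Ω] (P : Measure Ω) [IsProbabilityMeasure P]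
      (X : Ω → Set ℝ), IsPoissonProcess X (scaleInvariantIntensity θ) P →
      -- the cardinality of the symmetric difference is a random variable bounded in `L²`
      (AEMeasurable
          (fun ω => (symmDiff (spacingsBelowOne (X ω)) (smallSpacings (X ω))).encard) P ∧
        ∫⁻ ω, (((symmDiff (spacingsBelowOne (X ω)) (smallSpacings (X ω))).encard : ℕ∞) : ℝ≥0∞) ^ 2
          ∂P ≤ C) ∧
      ∀ f : ℝ → ℝ, Measurable f →
        -- for every `f`, the difference of the sums, with the common terms cancelled
        (AEMeasurable
            (fun ω => sumDifference (spacingsBelowOne (X ω)) (smallSpacings (X ω)) f) P ∧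
          ∫⁻ ω, ENNReal.ofReal
              (sumDifference (spacingsBelowOne (X ω)) (smallSpacings (X ω)) f ^ 2) ∂P
            ≤ C * (⨆ x, ‖f x‖ₑ) ^ 2) ∧
        -- the two sums converge absolutely on the same event, up to a null set
        (∀ᵐ ω ∂P, (Summable fun x : ↥(spacingsBelowOne (X ω)) => f x) ↔
          Summable fun x : ↥(smallSpacings (X ω)) => f x) ∧
        -- if they do so almost surely, the difference of the two sums themselves
        ((∀ᵐ ω ∂P, Summable fun x : ↥(spacingsBelowOne (X ω)) => f x) →
          AEMeasurable (fun ω => (∑' x : ↥(spacingsBelowOne (X ω)), f x) -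
              ∑' x : ↥(smallSpacings (X ω)), f x) P ∧
          ∫⁻ ω, ENNReal.ofReal (((∑' x : ↥(spacingsBelowOne (X ω)), f x) -
              ∑' x : ↥(smallSpacings (X ω)), f x) ^ 2) ∂P
            ≤ C * (⨆ x, ‖f x‖ₑ) ^ 2) := by
  have hC : 2 * closePairsMoment θ + 8 ≠ ∞ :=
    ENNReal.add_ne_top.2 ⟨ENNReal.mul_ne_top (by simp) (closePairsMoment_ne_top hθ.le), by simp⟩
  refine ⟨(2 * closePairsMoment θ + 8).toNNReal, fun Ω _ P _ X hX => ?_⟩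
  rw [ENNReal.coe_toNNReal hC]
  have hne : ∀ B : Set ℝ, MeasurableSet B → MeasurableSet {ω | (X ω ∩ B).Nonempty} :=
    fun B hB => hX.measurableSet_nonempty hB
  have hV := isMeasurablyEnumerated_spacingsBelowOne hne
  have hW := isMeasurablyEnumerated_smallSpacings hne
  have hcard := ((hV.diff hW).union (hW.diff hV)).measurable_encard
  have hmoment := hX.lintegral_encard_symmDiff_spacings_sq_le hθ
  have hm : Measurable fun ω =>
      (((symmDiff (spacingsBelowOne (X ω)) (smallSpacings (X ω))).encard : ℕ∞) : ℝ≥0∞) ^ 2 :=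
    (Measurable.of_discrete (f := fun n : ℕ∞ => (n : ℝ≥0∞) ^ 2)).comp hcard
  have hfin : ∀ᵐ ω ∂P, (symmDiff (spacingsBelowOne (X ω)) (smallSpacings (X ω))).Finite := by
    filter_upwards [ae_lt_top hm (ne_top_of_le_ne_top hC hmoment)] with ω hω
    rw [← encard_ne_top_iff]
    intro h
    simp [h] at hω
  refine ⟨⟨hcard.aemeasurable, hmoment⟩, fun f hf => ?_⟩
  have hmeas : Measurable fun ω =>
      sumDifference (spacingsBelowOne (X ω)) (smallSpacings (X ω)) f :=
    ((hV.diff hW).measurable_tsum hf).sub ((hW.diff hV).measurable_tsum hf)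
  have hbound : ∫⁻ ω, ENNReal.ofReal
      (sumDifference (spacingsBelowOne (X ω)) (smallSpacings (X ω)) f ^ 2) ∂P
        ≤ (2 * closePairsMoment θ + 8) * (⨆ x, ‖f x‖ₑ) ^ 2 := by
    refine (lintegral_mono fun ω => ofReal_sumDifference_sq_le _ _ f).trans ?_
    rw [lintegral_mul_const _ hm]
    gcongr
  refine ⟨⟨hmeas.aemeasurable, hbound⟩, ?_, fun hsum => ?_⟩
  · filter_upwards [hfin] with ω hω
    exact summable_subtype_iff_of_finite_symmDiff hω f
  -- Both measurability and the moment bound transfer along this almost sure equality.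
  · have hae : ∀ᵐ ω ∂P, sumDifference (spacingsBelowOne (X ω)) (smallSpacings (X ω)) f =
        (∑' x : ↥(spacingsBelowOne (X ω)), f x) - ∑' x : ↥(smallSpacings (X ω)), f x := by
      filter_upwards [hfin, hsum] with ω h1 h2
      exact (tsum_sub_tsum_eq_sumDifference h1 h2).symm
    refine ⟨hmeas.aemeasurable.congr hae, (lintegral_congr_ae ?_).trans_le hbound⟩
    filter_upwards [hae] with ω hω
    rw [hω]
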